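/- Consider the G/G/1 last-come-first-served queue with preemption. Update packets $n=0,1,2,\dots$ are generated at times $t_n=\sum_{k<n}X_k$, where the inter-generation times $X_k\ge 0$ are i.i.d. copies of $X$ with $\mathbb E[X]=1/\lambda\in(0,\infty)$. The service times $S_n\ge 0$ are i.i.d. with law $F_S$ and independent of the $X_k$. A unit-rate single server always works on the most recently generated packet among those present; a newly generated packet preempts the one in service, preempted packets are resumed later, and no packet is dropped. The age of information $A(t)$ is the minimum of $t-t_i$ over the packets $i$ whose service is completed by time $t$, and $A(t)=a_0+t$ before the first completion, where $a_0\ge 0$ is any fixed initial age. The average age is $A^{\mathrm{ave}}(F_S)=\limsup_{T\to\infty}\mathbb E\big[\frac1T\int_0^T A(t)\,dt\big]\in[0,\infty]$. Then, for every service time law $F_S$ on $[0,\infty)$, $$A^{\mathrm{ave}}(F_S)\ \ge\ \frac12\,\frac{\mathbb E[X^2]}{\mathbb E[X]}$$ (as an inequality in $[0,\infty]$). Let $\mu>0$. If $(S_\eta)$ is a parametric family of non-negative service times with atomless laws $F_{S_\eta}$ and $\mathbb E[S_\eta]=1/\mu$ for all $\eta$, such that for every $x>0$ we have $\mathbb P(S_\eta>x)\to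 0$ and $\mathbb E[S_\eta\mathbf 1\{S_\eta\le x\}]\to 0$ as $\eta\to\eta^*$, then $$\lim_{\eta\to\eta^*}A^{\mathrm{ave}}(F_{S_\eta})=\frac12\,\frac{\mathbb E[X^2]}{\mathbb E[X]}.$$ Further, $A^{\mathrm{ave}}(F_S)\to\frac12\,\mathbb E[X^2]/\mathbb E[X]$ in each of the following three cases, in each of which $F_S$ is a probability law with mean $1/\mu$ for every value of the parameter: 1. Pareto service, $F_S(s)=1-(\theta/s)^{\alpha}$ for $s\ge\theta$ and $F_S(s)=0$ for $s<\theta$, with $\theta=\frac1\mu\big(1-\frac1\alpha\big)$ and $\alpha>1$, as $\alpha\downarrow 1$; 2. log-normal service, $S=\exp\{-\log\mu-\frac{\sigma^2}{2}+\sigma N\}$ with $N\sim\mathcal N(0,1)$ and $\sigma>0$, as $\sigma\to+\infty$; 3. Weibull service, $F_S(s)=1-e^{-(s/\beta)^{\kappa}}$ for $s\ge 0$, with $\beta=[\mu\,\Gamma(1+1/\kappa)]^{-1}$ and $\kappa>0$, as $\kappa\downarrow 0$. -/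

import Mathlib

open MeasureTheory ProbabilityTheory Filter Topology
open scoped ENNReal

namespace LCFSp

/-! ### The single-server last-come-first-served queue with preemption

Packet `n` (for `n = 0, 1, 2, …`) is generated at time `genTime x n`, where `x n` is the time
between the generations of packets `n` and `n + 1`, and it requires the amount `s n` of service.
The content of the system is a stack of pairs (packet, remaining service requirement). The server
works at unit rate on the top of the stack, a newly generated packet is put on top (so it preempts
the packet in service), and a packet leaves the stack, i.e. is received by the destination, when
its remaining service requirement is exhausted. No packet is dropped, and preempted packets are
resumed later. -/

/-- Generation time of packet `n`. -/
noncomputable def genTime (x : ℕ → ℝ) (n : ℕ) : ℝ := ∑ k ∈ Finset.range n, x k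

/-- The stack after the server has worked for a duration `d` without new generations. -/
noncomputable def serve : ℝ → List (ℕ × ℝ) → List (ℕ × ℝ)
  | _, [] => []
  | d, (i, r) :: L => if d < r then (i, r - d) :: L else serve (d - r) L

/-- The stack just after the generation of packet `n`. -/
noncomputable def stack (x s : ℕ → ℝ) : ℕ → List (ℕ × ℝ)
  | 0 => [(0, s 0)]
  | n + 1 => (n + 1, s (n + 1)) :: serve (x n) (stack x s n)

/-- Packet `i` has been received by the destination up to time `t`: if `n` is the last packet
generated up to time `t`, then `i ≤ n` and packet `i` is not in the stack at time `t`. -/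
def Received (x s : ℕ → ℝ) (t : ℝ) (i : ℕ) : Prop :=
  ∃ n, genTime x n ≤ t ∧ t < genTime x (n + 1) ∧ i ≤ n ∧
    ∀ p ∈ serve (t - genTime x n) (stack x s n), p.1 ≠ i

/-- The age of information at the destination at time `t`: the minimum of `t - genTime x i` over
all packets `i` received up to time `t`. The age at time `0` is `a₀`, so the age is `a₀ + t` as
long as nothing has been received (later this term does not affect the minimum). -/
noncomputable def age (a₀ : ℝ) (x s : ℕ → ℝ) (t : ℝ) : ℝ≥0∞ :=
  ENNReal.ofReal (a₀ + t) ⊓ ⨅ (i : ℕ) (_ : Received x s t i), ENNReal.ofReal (t - genTime x i)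

/-- The law of the i.i.d. sequence of pairs (inter-generation time, service time), with
inter-generation law `FX`, service law `FS`, and independence between the two. -/
noncomputable def inputLaw (FX FS : Measure ℝ) : Measure (ℕ → ℝ × ℝ) :=
  Measure.infinitePi (fun _ : ℕ => FX.prod FS)

/-- The average age `limsup_{T → ∞} E[(1/T) ∫₀ᵀ A(t) dt]` of the G/G/1 LCFS-preemptive queue. -/
noncomputable def averageAge (a₀ : ℝ) (FX FS : Measure ℝ) : ℝ≥0∞ :=
  limsup (fun T : ℝ => ∫⁻ w, (ENNReal.ofReal T)⁻¹ *
      (∫⁻ t in Set.Ioc 0 T, age a₀ (fun n => (w n).1) (fun n => (w n).2) t) ∂(inputLaw FX FS))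
    atTop

/-- The quantity `E[X²] / (2 E[X])`, in `[0, ∞]`. -/
noncomputable def minAge (FX : Measure ℝ) : ℝ≥0∞ :=
  (∫⁻ x, ENNReal.ofReal (x ^ 2) ∂FX) / (2 * ∫⁻ x, ENNReal.ofReal x ∂FX)

/-! ### The three service time distributions with mean `1 / μ` -/

/-- Pareto law with shape `α` and scale `(1 / μ) (1 - 1 / α)`. -/
noncomputable def paretoService (mu α : ℝ) : Measure ℝ :=
  paretoMeasure (1 / mu * (1 - 1 / α)) α

/-- Law of `exp (- log μ - σ² / 2 + σ N)` with `N` standard normal. -/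
noncomputable def logNormalService (mu σ : ℝ) : Measure ℝ :=
  (gaussianReal 0 1).map (fun z => Real.exp (-Real.log mu - σ ^ 2 / 2 + σ * z))

/-- The Weibull scale `[μ Γ(1 + 1/κ)]⁻¹`. -/
noncomputable def weibullScale (mu κ : ℝ) : ℝ := (mu * Real.Gamma (1 + 1 / κ))⁻¹

/-- Weibull law with shape `κ` and scale `β = weibullScale mu κ`, through its density
`(κ / β) (s / β) ^ (κ - 1) exp (-(s / β) ^ κ)` on `s > 0`. -/
noncomputable def weibullService (mu κ : ℝ) : Measure ℝ :=
  (volume.restrict (Set.Ioi 0)).withDensity (fun s => ENNReal.ofReal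
    (κ / weibullScale mu κ * (s / weibullScale mu κ) ^ (κ - 1) *
      Real.exp (-(s / weibullScale mu κ) ^ κ)))

end LCFSp

/-!
The age never falls below the time since the last generation, and it equals this time once the last
packet has been served. Hence a service law only matters through the periods before the service of
the packet on top, and these vanish if the service times tend to zero in probability.

Write `t_n` for the generation times, `X_n` and `S_n` for the inter-generation and service times,
and `M(T) = ∑ₙ P(t_n ≤ T)` for the renewal function. Since `{t_n ≤ T}` depends on the packets
before `n` only, Wald's identity `E ∑ₙ 1{t_n ≤ T} g(X_n, S_n) = M(T) E g(X, S)` holds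
(`lintegral_tsum_arrived_mul`). With `g = X` and `g = min(X, c)` it gives
`T / E[X] ≤ M(T) ≤ (T + c) / E[min(X, c)]`, hence the elementary renewal theorem `M(T) ∼ T / E[X]`.

For the lower bound, each generation up to time `T - c` contributes at least `min(X_n, c)² / 2` to
the integral of the age over `[0, T]`. Apply Wald's identity, divide by `T`, and let first `T` and
then `c` tend to infinity (`minAge_le_averageAge`).

For the upper bound, only packets with `S_n ≤ X_n` are taken into account. They give an upper bound
`B_n` for the age at time `t_n` with `B_{n+1} = X_n + 1{S_n > X_n} B_n` (`ageBound`), and the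
interval `[t_n, t_{n+1})` contributes at most `X_n² / 2 + B_n min(X_n, S_n)`. As `B_n` is
independent of `(X_n, S_n)`, the recursion yields
`P(S ≤ X) ∑ₙ E[B_n 1{t_n ≤ T}] ≤ a₀ + M(T) E[X]` (`servedProb_mul_tsum_le`). If `E[X²]` is finite,
the average age is therefore at most `E[X²] / (2 E[X]) + E[min(X, S)] / P(S ≤ X)`
(`averageAge_le`); otherwise the lower bound is already infinite.

If `P(S > x) → 0` for every `x > 0`, then `E[min(X, S)] → 0`, while `P(S ≤ X)` stays away from
zero, because `X` is not concentrated at zero (`tendsto_averageAge`). For the three parametric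
families it remains to compute the mean and to bound the tail: exactly for the Pareto law, by
Chernoff's inequality for the log-normal law, and by Markov's inequality for the moment of order `κ`
together with `Γ(1 + m) ≥ m ^ m e ^ (-m)` for the Weibull law.
-/

namespace LCFSp

/-! ### The sample paths of the queue -/

lemma genTime_succ (x : ℕ → ℝ) (n : ℕ) : genTime x (n + 1) = genTime x n + x n :=
  Finset.sum_range_succ _ _

lemma genTime_mono {x : ℕ → ℝ} (hx : ∀ n, 0 ≤ x n) : Monotone (genTime x) :=
  monotone_nat_of_le_succ fun n => by rw [genTime_succ]; linarith [hx n]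

lemma genTime_nonneg {x : ℕ → ℝ} (hx : ∀ n, 0 ≤ x n) (n : ℕ) : 0 ≤ genTime x n :=
  Finset.sum_nonneg fun k _ => hx k

lemma exists_mem_of_mem_serve {L : List (ℕ × ℝ)} {d : ℝ} {p : ℕ × ℝ} (hp : p ∈ serve d L) :
    ∃ q ∈ L, q.1 = p.1 := by
  induction L generalizing d with
  | nil => simp [serve] at hp
  | cons a L ih =>
    rw [serve] at hp
    split_ifs at hp with h
    · rcases List.mem_cons.1 hp with rfl | hp
      · exact ⟨a, by simp, rfl⟩
      · exact ⟨p, by simp [hp], rfl⟩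
    · obtain ⟨q, hq, h⟩ := ih hp
      exact ⟨q, by simp [hq], h⟩

/-- Just after its generation, packet `n` is on top of strictly older packets. -/
lemma exists_stack_eq_cons (x s : ℕ → ℝ) (n : ℕ) :
    ∃ L, stack x s n = (n, s n) :: L ∧ ∀ p ∈ L, p.1 < n := by
  induction n with
  | zero => exact ⟨[], rfl, by simp⟩
  | succ n ih =>
    refine ⟨_, rfl, fun p hp => ?_⟩
    obtain ⟨L, hL, hlt⟩ := ih
    obtain ⟨q, hq, hqp⟩ := exists_mem_of_mem_serve hp
    rw [hL, List.mem_cons] at hq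
    rcases hq with rfl | hq
    · simp only at hqp; omega
    · have := hlt q hq; omega

/-- Packet `n` has left the stack as soon as the server has worked for its service time. -/
lemma ne_of_mem_serve_stack {x s : ℕ → ℝ} {n : ℕ} {d : ℝ} (hd : s n ≤ d) {p : ℕ × ℝ}
    (hp : p ∈ serve d (stack x s n)) : p.1 ≠ n := by
  obtain ⟨L, hL, hlt⟩ := exists_stack_eq_cons x s n
  rw [hL, serve, if_neg hd.not_gt] at hp
  obtain ⟨q, hq, hqp⟩ := exists_mem_of_mem_serve hp
  have := hlt q hq
  omega

/-- A packet served before the next generation never shows up in the stack again. -/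
lemma ne_of_mem_stack {x s : ℕ → ℝ} {j n : ℕ} (hj : s j ≤ x j) (hn : j < n) {p : ℕ × ℝ}
    (hp : p ∈ stack x s n) : p.1 ≠ j := by
  induction n, hn using Nat.le_induction generalizing p with
  | base =>
    rcases List.mem_cons.1 hp with rfl | hp
    · simp
    · exact ne_of_mem_serve_stack hj hp
  | succ n hn ih =>
    rcases List.mem_cons.1 hp with rfl | hp
    · simp only; omega
    · obtain ⟨q, hq, hqp⟩ := exists_mem_of_mem_serve hp
      rw [← hqp]
      exact ih hq

lemma received_self {x s : ℕ → ℝ} {n : ℕ} {t : ℝ} (h₁ : genTime x n ≤ t)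
    (h₂ : t < genTime x (n + 1)) (hs : s n ≤ t - genTime x n) : Received x s t n :=
  ⟨n, h₁, h₂, le_rfl, fun _ hp => ne_of_mem_serve_stack hs hp⟩

lemma received_of_lt {x s : ℕ → ℝ} {j n : ℕ} {t : ℝ} (h₁ : genTime x n ≤ t)
    (h₂ : t < genTime x (n + 1)) (hj : s j ≤ x j) (hn : j < n) : Received x s t j := by
  refine ⟨n, h₁, h₂, hn.le, fun p hp => ?_⟩
  obtain ⟨q, hq, hqp⟩ := exists_mem_of_mem_serve hp
  rw [← hqp]
  exact ne_of_mem_stack hj hn hq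

/-- The age is at least the time since the last generation. -/
lemma ofReal_sub_genTime_le_age {a₀ : ℝ} (ha₀ : 0 ≤ a₀) {x s : ℕ → ℝ} (hx : ∀ n, 0 ≤ x n)
    {n : ℕ} {t : ℝ} (h₂ : t < genTime x (n + 1)) :
    ENNReal.ofReal (t - genTime x n) ≤ age a₀ x s t := by
  refine le_inf (ENNReal.ofReal_le_ofReal ?_) (le_iInf₂ fun i hi => ENNReal.ofReal_le_ofReal ?_)
  · linarith [genTime_nonneg hx n]
  · obtain ⟨m, hm, -, him, -⟩ := hi
    have hmn : m ≤ n := by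
      by_contra! h
      have := genTime_mono hx (Nat.succ_le_of_lt h)
      simp only [Nat.succ_eq_add_one] at this
      linarith
    linarith [genTime_mono hx (him.trans hmn)]

/-- An upper bound for the age at the generation of packet `n`: the time since the generation of
the last packet that was served before its successor was generated, and the initial age plus the
elapsed time if there is no such packet. -/
noncomputable def ageBound (a₀ : ℝ) (x s : ℕ → ℝ) : ℕ → ℝ≥0∞
  | 0 => ENNReal.ofReal a₀
  | n + 1 => ENNReal.ofReal (x n) + if s n ≤ x n then 0 else ageBound a₀ x s n

lemma ageBound_cases (a₀ : ℝ) (x s : ℕ → ℝ) (n : ℕ) :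
    ENNReal.ofReal (a₀ + genTime x n) ≤ ageBound a₀ x s n ∨
      ∃ j < n, s j ≤ x j ∧ ENNReal.ofReal (genTime x n - genTime x j) ≤ ageBound a₀ x s n := by
  induction n with
  | zero => left; simp [ageBound, genTime]
  | succ n ih =>
    by_cases h : s n ≤ x n
    · right
      refine ⟨n, Nat.lt_succ_self n, h, ?_⟩
      rw [ageBound, if_pos h, genTime_succ]
      simp
    · rw [ageBound, if_neg h]
      rcases ih with ih | ⟨j, hj, hs, ih⟩
      · left
        rw [show a₀ + genTime x (n + 1) = x n + (a₀ + genTime x n) by rw [genTime_succ]; ring]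
        exact ENNReal.ofReal_add_le.trans (by gcongr)
      · right
        refine ⟨j, by omega, hs, ?_⟩
        rw [show genTime x (n + 1) - genTime x j = x n + (genTime x n - genTime x j) by
          rw [genTime_succ]; ring]
        exact ENNReal.ofReal_add_le.trans (by gcongr)

/-- Between two generations, the age exceeds the time since the last generation by at most
`ageBound`, and not at all once the last packet has been served. -/
lemma age_le {a₀ : ℝ} {x s : ℕ → ℝ} {n : ℕ} {t : ℝ}
    (h₁ : genTime x n ≤ t) (h₂ : t < genTime x (n + 1)) :
    age a₀ x s t ≤ ENNReal.ofReal (t - genTime x n) +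
      (Set.Ico (genTime x n) (genTime x n + min (x n) (s n))).indicator
        (fun _ => ageBound a₀ x s n) t := by
  by_cases hs : s n ≤ t - genTime x n
  · exact (inf_le_right.trans (iInf₂_le n (received_self h₁ h₂ hs))).trans le_self_add
  · have hmem : t ∈ Set.Ico (genTime x n) (genTime x n + min (x n) (s n)) := by
      refine ⟨h₁, ?_⟩
      rw [genTime_succ] at h₂
      rw [← sub_lt_iff_lt_add']
      exact lt_min (by linarith) (by linarith)
    rw [Set.indicator_of_mem hmem]
    rcases ageBound_cases a₀ x s n with h | ⟨j, hj, hsj, h⟩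
    · refine inf_le_left.trans ?_
      rw [show a₀ + t = (t - genTime x n) + (a₀ + genTime x n) by ring]
      exact ENNReal.ofReal_add_le.trans (by gcongr)
    · refine (inf_le_right.trans (iInf₂_le j (received_of_lt h₁ h₂ hsj hj))).trans ?_
      rw [show t - genTime x j = (t - genTime x n) + (genTime x n - genTime x j) by ring]
      exact ENNReal.ofReal_add_le.trans (by gcongr)

/-! ### The integral of the age along a sample path -/

lemma lintegral_Ico_sub {a d : ℝ} (hd : 0 ≤ d) :
    ∫⁻ t in Set.Ico a (a + d), ENNReal.ofReal (t - a) = ENNReal.ofReal (d ^ 2 / 2) := by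
  rw [restrict_Ico_eq_restrict_Ioc, ← ofReal_integral_eq_lintegral_ofReal,
    ← intervalIntegral.integral_of_le (by linarith)]
  · congr 1
    rw [intervalIntegral.integral_comp_sub_right (fun t => t), integral_id]
    ring
  · exact ((continuous_id.sub continuous_const).integrableOn_Icc).mono_set Set.Ioc_subset_Icc_self
  · filter_upwards [ae_restrict_mem measurableSet_Ioc] with t ht
    simpa using ht.1.le

/-- `arrived T x n` is `1` if packet `n` is generated up to time `T`, and `0` otherwise. -/
noncomputable def arrived (T : ℝ) (x : ℕ → ℝ) (n : ℕ) : ℝ≥0∞ :=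
  if genTime x n ≤ T then 1 else 0

/-- Lower bound for the integral of the age: the first `c` time units after each generation up to
time `T - c` lie in `[0, T]`. -/
lemma tsum_le_lintegral_age {a₀ : ℝ} (ha₀ : 0 ≤ a₀) {x : ℕ → ℝ} (s : ℕ → ℝ)
    (hx : ∀ n, 0 ≤ x n) {c T : ℝ} (hc : 0 ≤ c) :
    ∑' n, arrived (T - c) x n * ENNReal.ofReal (min (x n) c ^ 2 / 2) ≤
      ∫⁻ t in Set.Ioc 0 T, age a₀ x s t := by
  set A : ℕ → Set ℝ := fun n => if genTime x n ≤ T - c then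
    Set.Ico (genTime x n) (genTime x n + min (x n) c) else ∅ with hA
  have hAico : ∀ n, A n ⊆ Set.Ico (genTime x n) (genTime x (n + 1)) := by
    intro n
    simp only [hA]
    split_ifs
    · rw [genTime_succ]
      exact Set.Ico_subset_Ico_right (by gcongr; exact min_le_left _ _)
    · exact Set.empty_subset _
  have hdisj : Pairwise (Function.onFun Disjoint A) := fun i j hij =>
    ((genTime_mono hx).pairwise_disjoint_on_Ico_succ hij).mono (hAico i) (hAico j)
  have hmeas : ∀ n, MeasurableSet (A n) := by
    intro n
    simp only [hA]
    split_ifs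
    · exact measurableSet_Ico
    · exact MeasurableSet.empty
  have hsub : (⋃ n, A n) ⊆ Set.Icc 0 T := by
    refine Set.iUnion_subset fun n t ht => ?_
    simp only [hA] at ht
    split_ifs at ht with h
    · exact ⟨(genTime_nonneg hx n).trans ht.1,
        by linarith [ht.2, min_le_right (x n) c]⟩
    · exact ht.elim
  calc ∑' n, arrived (T - c) x n * ENNReal.ofReal (min (x n) c ^ 2 / 2)
      = ∑' n, ∫⁻ t in A n, ENNReal.ofReal (t - genTime x n) := by
        congr 1 with n
        simp only [hA, arrived]
        split_ifs
        · rw [lintegral_Ico_sub (le_min (hx n) hc), one_mul]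
        · simp
    _ ≤ ∑' n, ∫⁻ t in A n, age a₀ x s t := by
        refine ENNReal.tsum_le_tsum fun n => setLIntegral_mono' (hmeas n) fun t ht => ?_
        exact ofReal_sub_genTime_le_age ha₀ hx (hAico n ht).2
    _ = ∫⁻ t in ⋃ n, A n, age a₀ x s t := (lintegral_iUnion hmeas hdisj _).symm
    _ ≤ ∫⁻ t in Set.Icc 0 T, age a₀ x s t := lintegral_mono_set hsub
    _ = ∫⁻ t in Set.Ioc 0 T, age a₀ x s t := by rw [restrict_Ioc_eq_restrict_Icc]

lemma lintegral_age_le {a₀ : ℝ} {x s : ℕ → ℝ} (hx : ∀ n, 0 ≤ x n)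
    (htop : Tendsto (genTime x) atTop atTop) (T : ℝ) :
    ∫⁻ t in Set.Ioc 0 T, age a₀ x s t ≤
      ∑' n, arrived T x n *
        (ENNReal.ofReal (x n ^ 2 / 2) + ageBound a₀ x s n * ENNReal.ofReal (min (x n) (s n))) := by
  set A : ℕ → Set ℝ := fun n => if genTime x n ≤ T then
    Set.Ico (genTime x n) (genTime x n + x n) else ∅ with hA
  have hsub : Set.Ioc 0 T ⊆ ⋃ n, A n := by
    intro t ht
    have hex : ∃ n, t < genTime x n := (htop.eventually_gt_atTop t).exists
    obtain ⟨m, hm⟩ : ∃ m, Nat.find hex = m + 1 := by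
      refine Nat.exists_eq_succ_of_ne_zero fun h => ?_
      have := Nat.find_spec hex
      rw [h] at this
      simp only [genTime, Finset.range_zero, Finset.sum_empty] at this
      exact absurd ht.1 this.not_gt
    have h₁ : genTime x m ≤ t := not_lt.1 (Nat.find_min hex (by omega))
    have h₂ : t < genTime x (m + 1) := hm ▸ Nat.find_spec hex
    refine Set.mem_iUnion.2 ⟨m, ?_⟩
    simp only [hA]
    rw [if_pos (h₁.trans ht.2), ← genTime_succ]
    exact ⟨h₁, h₂⟩
  refine (lintegral_mono_set hsub).trans ((lintegral_iUnion_le A _).trans ?_)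
  refine ENNReal.tsum_le_tsum fun n => ?_
  simp only [hA, arrived]
  split_ifs
  · rw [one_mul]
    calc ∫⁻ t in Set.Ico (genTime x n) (genTime x n + x n), age a₀ x s t
        ≤ ∫⁻ t in Set.Ico (genTime x n) (genTime x n + x n), (ENNReal.ofReal (t - genTime x n) +
          (Set.Ico (genTime x n) (genTime x n + min (x n) (s n))).indicator
            (fun _ => ageBound a₀ x s n) t) := by
          refine setLIntegral_mono' measurableSet_Ico fun t ht => age_le ht.1 ?_
          rw [genTime_succ]
          exact ht.2
      _ ≤ _ := by
          rw [lintegral_add_left (by fun_prop), lintegral_Ico_sub (hx n)]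
          gcongr
          refine (setLIntegral_le_lintegral _ _).trans ?_
          rw [lintegral_indicator measurableSet_Ico, setLIntegral_const, Real.volume_Ico,
            add_sub_cancel_left]
  · simp

/-- Up to time `T`, the truncated inter-generation times sum up to at most `T + c`. -/
lemma tsum_arrived_min_le {x : ℕ → ℝ} (hx : ∀ n, 0 ≤ x n) {c T : ℝ} (hc : 0 ≤ c) :
    ∑' n, arrived T x n * ENNReal.ofReal (min (x n) c) ≤ ENNReal.ofReal (T + c) := by
  refine ENNReal.tsum_le_of_sum_range_le fun n => ?_
  suffices h : ∑ k ∈ Finset.range n, arrived T x k * ENNReal.ofReal (min (x k) c) ≤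
      ENNReal.ofReal (min (genTime x n) (T + c)) from
    h.trans (ENNReal.ofReal_le_ofReal (min_le_right _ _))
  induction n with
  | zero => simp
  | succ n ih =>
    rw [Finset.sum_range_succ, arrived]
    split_ifs with h
    · have h0 := genTime_nonneg hx n
      rw [min_eq_left (by linarith)] at ih
      rw [one_mul]
      refine (add_le_add_left ih _).trans ?_
      rw [← ENNReal.ofReal_add h0 (le_min (hx n) hc), genTime_succ]
      refine ENNReal.ofReal_le_ofReal (le_min ?_ ?_)
      · linarith [min_le_left (x n) c]
      · linarith [min_le_right (x n) c]
    · rw [zero_mul, add_zero]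
      exact ih.trans (ENNReal.ofReal_le_ofReal
        (min_le_min_right _ (genTime_mono hx (Nat.le_succ n))))

/-- The intervals between generations that start up to time `T` cover `[0, T]`. -/
lemma ofReal_le_tsum_arrived {x : ℕ → ℝ}
    (htop : Tendsto (genTime x) atTop atTop) (T : ℝ) :
    ENNReal.ofReal T ≤ ∑' n, arrived T x n * ENNReal.ofReal (x n) := by
  obtain ⟨n, hn⟩ := (htop.eventually_gt_atTop T).exists
  refine le_trans ?_ (ENNReal.sum_le_tsum (Finset.range n))
  suffices h : ENNReal.ofReal (min (genTime x n) T) ≤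
      ∑ k ∈ Finset.range n, arrived T x k * ENNReal.ofReal (x k) by
    rwa [min_eq_right hn.le] at h
  clear hn
  induction n with
  | zero => simp [genTime]
  | succ n ih =>
    rw [Finset.sum_range_succ, arrived]
    split_ifs with h
    · rw [min_eq_left h] at ih
      rw [one_mul]
      refine (ENNReal.ofReal_le_ofReal (min_le_left _ _)).trans ?_
      rw [genTime_succ]
      exact ENNReal.ofReal_add_le.trans (by gcongr)
    · rw [zero_mul, add_zero]
      refine le_trans (ENNReal.ofReal_le_ofReal ?_) ih
      rw [min_eq_right (not_le.1 h).le]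
      exact min_le_right _ _

/-! ### Independence of a packet from the past -/

/-- The σ-algebra generated by the data of the packets `0, …, n - 1`. -/
@[reducible] def past (n : ℕ) : MeasurableSpace (ℕ → ℝ × ℝ) :=
  ⨆ k ∈ Set.Iio n, MeasurableSpace.comap (fun w => w k) inferInstance

lemma past_le (n : ℕ) : past n ≤ MeasurableSpace.pi :=
  iSup₂_le fun k _ => (measurable_pi_apply k).comap_le

lemma past_mono {m n : ℕ} (h : m ≤ n) : past m ≤ past n :=
  biSup_mono fun _ hk => lt_of_lt_of_le hk h

lemma measurable_past_eval {k n : ℕ} (h : k < n) : Measurable[past n] fun w => w k :=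
  measurable_iff_comap_le.2 (le_iSup₂_of_le k h le_rfl)

lemma measurable_past_genTime (n : ℕ) :
    Measurable[past n] fun w : ℕ → ℝ × ℝ => genTime (fun k => (w k).1) n := by
  simp only [genTime]
  refine Finset.measurable_sum _ fun k hk => ?_
  exact measurable_fst.comp (measurable_past_eval (Finset.mem_range.1 hk))

lemma measurable_past_arrived (T : ℝ) (n : ℕ) :
    Measurable[past n] fun w : ℕ → ℝ × ℝ => arrived T (fun k => (w k).1) n := by
  simp only [arrived]
  refine Measurable.ite ?_ measurable_const measurable_const
  exact measurable_past_genTime n measurableSet_Iic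

lemma measurable_past_ageBound (a₀ : ℝ) (n : ℕ) :
    Measurable[past n] fun w : ℕ → ℝ × ℝ =>
      ageBound a₀ (fun k => (w k).1) (fun k => (w k).2) n := by
  induction n with
  | zero => exact measurable_const
  | succ n ih =>
    have hw : Measurable[past (n + 1)] fun w : ℕ → ℝ × ℝ => w n :=
      measurable_past_eval n.lt_succ_self
    simp only [ageBound]
    refine Measurable.add ?_ (Measurable.ite ?_ measurable_const
      (ih.mono (past_mono n.le_succ) le_rfl))
    · exact (ENNReal.measurable_ofReal.comp measurable_fst).comp hw
    · exact hw (measurableSet_le measurable_snd measurable_fst)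

lemma lintegral_prod_fst (FX FS : Measure ℝ) [SFinite FX] [IsProbabilityMeasure FS] {g : ℝ → ℝ≥0∞} (hg : Measurable g) :
    ∫⁻ z, g z.1 ∂(FX.prod FS) = ∫⁻ x, g x ∂FX :=
  measurePreserving_fst.lintegral_comp hg

section

variable (FX FS : Measure ℝ) [IsProbabilityMeasure FX] [IsProbabilityMeasure FS]

lemma lintegral_eval {g : ℝ × ℝ → ℝ≥0∞} (hg : Measurable g) (n : ℕ) :
    ∫⁻ w, g (w n) ∂(inputLaw FX FS) = ∫⁻ z, g z ∂(FX.prod FS) :=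
  (measurePreserving_eval_infinitePi (fun _ : ℕ => FX.prod FS) n).lintegral_comp hg

/-- Packet `n` is independent of the packets before it. -/
lemma lintegral_past_mul {n : ℕ} {f : (ℕ → ℝ × ℝ) → ℝ≥0∞} (hf : Measurable[past n] f)
    {g : ℝ × ℝ → ℝ≥0∞} (hg : Measurable g) :
    ∫⁻ w, f w * g (w n) ∂(inputLaw FX FS) =
      (∫⁻ w, f w ∂(inputLaw FX FS)) * ∫⁻ z, g z ∂(FX.prod FS) := by
  have hle : ∀ k : ℕ, MeasurableSpace.comap (fun w : ℕ → ℝ × ℝ => w k) inferInstance ≤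
      MeasurableSpace.pi := fun k => (measurable_pi_apply k).comap_le
  have hind : iIndep (fun k : ℕ => MeasurableSpace.comap (fun w : ℕ → ℝ × ℝ => w k) inferInstance)
      (inputLaw FX FS) :=
    (iIndepFun_infinitePi (P := fun _ : ℕ => FX.prod FS) (X := fun _ z => z)
      fun _ => measurable_id).iIndep
  have h := indep_iSup_of_disjoint hle hind (S := Set.Iio n) (T := {n}) (by simp)
  rw [iSup_singleton] at h
  rw [← lintegral_eval FX FS hg n]
  exact lintegral_mul_eq_lintegral_mul_lintegral_of_independent_measurableSpace
    (past_le n) (hle n) h hf (hg.comp (comap_measurable _))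

variable {FX} in
lemma ae_forall_nonneg (hX : ∀ᵐ x ∂FX, 0 ≤ x) :
    ∀ᵐ w ∂(inputLaw FX FS), ∀ n, 0 ≤ (w n).1 := by
  refine ae_all_iff.2 fun n => ?_
  have h : MeasurePreserving (fun w : ℕ → ℝ × ℝ => (w n).1) (inputLaw FX FS) FX :=
    measurePreserving_fst.comp (measurePreserving_eval_infinitePi (fun _ : ℕ => FX.prod FS) n)
  exact h.quasiMeasurePreserving.ae hX

/-! ### The renewal process of the generation times -/

/-- The expected number of packets generated up to time `T`. -/
noncomputable def renewal (T : ℝ) : ℝ≥0∞ :=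
  ∑' n, ∫⁻ w, arrived T (fun k => (w k).1) n ∂(inputLaw FX FS)

/-- Wald's identity. -/
lemma lintegral_tsum_arrived_mul (T : ℝ) {g : ℝ × ℝ → ℝ≥0∞} (hg : Measurable g) :
    ∫⁻ w, ∑' n, arrived T (fun k => (w k).1) n * g (w n) ∂(inputLaw FX FS) =
      renewal FX FS T * ∫⁻ z, g z ∂(FX.prod FS) := by
  rw [lintegral_tsum fun n => ?_, renewal, ← ENNReal.tsum_mul_right]
  · exact tsum_congr fun n => lintegral_past_mul FX FS (measurable_past_arrived T n) hg
  · exact (((measurable_past_arrived T n).mono (past_le n) le_rfl).mul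
      (hg.comp (measurable_pi_apply n))).aemeasurable

variable {FX}

lemma renewal_mul_le (hX : ∀ᵐ x ∂FX, 0 ≤ x) {c : ℝ} (hc : 0 ≤ c) (T : ℝ) :
    renewal FX FS T * ∫⁻ x, ENNReal.ofReal (min x c) ∂FX ≤ ENNReal.ofReal (T + c) := by
  rw [← lintegral_prod_fst FX FS (by fun_prop), ← lintegral_tsum_arrived_mul FX FS T (by fun_prop)]
  refine (lintegral_mono_ae ?_).trans_eq (by
    rw [lintegral_const, inputLaw, measure_univ, mul_one])
  filter_upwards [ae_forall_nonneg FS hX] with w hw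
  exact tsum_arrived_min_le hw hc

lemma renewal_ne_top (hX : ∀ᵐ x ∂FX, 0 ≤ x) {c : ℝ} (hc : 0 ≤ c)
    (hpos : ∫⁻ x, ENNReal.ofReal (min x c) ∂FX ≠ 0) (T : ℝ) : renewal FX FS T ≠ ∞ := by
  intro h
  have := renewal_mul_le FS hX hc T
  rw [h, ENNReal.top_mul hpos] at this
  exact absurd this (by simp)

/-- Only finitely many packets are generated in finite time. -/
lemma ae_tendsto_genTime (hX : ∀ᵐ x ∂FX, 0 ≤ x) {c : ℝ} (hc : 0 ≤ c)
    (hpos : ∫⁻ x, ENNReal.ofReal (min x c) ∂FX ≠ 0) :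
    ∀ᵐ w ∂(inputLaw FX FS), Tendsto (genTime fun k => (w k).1) atTop atTop := by
  have key : ∀ T : ℕ, ∀ᵐ w ∂(inputLaw FX FS), ∀ᶠ n in atTop,
      w ∉ {w : ℕ → ℝ × ℝ | genTime (fun k => (w k).1) n ≤ T} := by
    intro T
    refine ae_eventually_notMem ?_
    have h := renewal_ne_top FS hX hc hpos T
    rw [renewal] at h
    convert h using 3 with n
    rw [← lintegral_indicator_one]
    · rfl
    · exact past_le n _ (measurable_past_genTime n measurableSet_Iic)
  filter_upwards [ae_all_iff.2 key] with w hw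
  refine tendsto_atTop.2 fun b => ?_
  obtain ⟨T, hT⟩ := exists_nat_ge b
  filter_upwards [hw T] with n hn
  exact hT.trans (not_le.1 hn).le

lemma ofReal_le_renewal_mul (hX : ∀ᵐ x ∂FX, 0 ≤ x) {c : ℝ} (hc : 0 ≤ c)
    (hpos : ∫⁻ x, ENNReal.ofReal (min x c) ∂FX ≠ 0) (T : ℝ) :
    ENNReal.ofReal T ≤ renewal FX FS T * ∫⁻ x, ENNReal.ofReal x ∂FX := by
  rw [← lintegral_prod_fst FX FS (by fun_prop), ← lintegral_tsum_arrived_mul FX FS T (by fun_prop)]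
  calc ENNReal.ofReal T = ∫⁻ _, ENNReal.ofReal T ∂(inputLaw FX FS) := by
        rw [lintegral_const, inputLaw, measure_univ, mul_one]
    _ ≤ _ := by
        refine lintegral_mono_ae ?_
        filter_upwards [ae_tendsto_genTime FS hX hc hpos] with w hw
        exact ofReal_le_tsum_arrived hw T

end

section

variable {FX : Measure ℝ}

/-! ### Truncated moments and the minimal age -/

lemma lintegral_min_ne_zero (hm : ∫⁻ x, ENNReal.ofReal x ∂FX ≠ 0) {c : ℝ} (hc : 0 < c) :
    ∫⁻ x, ENNReal.ofReal (min x c) ∂FX ≠ 0 := by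
  contrapose! hm
  rw [lintegral_eq_zero_iff (by fun_prop)] at hm ⊢
  filter_upwards [hm] with x hx
  simp only [Pi.zero_apply, ENNReal.ofReal_eq_zero, min_le_iff, hc.not_ge, or_false] at hx ⊢
  exact hx

lemma tendsto_lintegral_min :
    Tendsto (fun c : ℕ => ∫⁻ x, ENNReal.ofReal (min x c) ∂FX) atTop
      (𝓝 (∫⁻ x, ENNReal.ofReal x ∂FX)) := by
  refine lintegral_tendsto_of_tendsto_of_monotone (fun c => by fun_prop) ?_ ?_
  · refine ae_of_all _ fun x a b hab => ?_
    dsimp only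
    gcongr
  · refine ae_of_all _ fun x => tendsto_const_nhds.congr' ?_
    filter_upwards [eventually_ge_atTop ⌈x⌉₊] with c hc
    rw [min_eq_left ((Nat.le_ceil x).trans (by exact_mod_cast hc))]

lemma tendsto_lintegral_min_sq (hX : ∀ᵐ x ∂FX, 0 ≤ x) :
    Tendsto (fun c : ℕ => ∫⁻ x, ENNReal.ofReal (min x c ^ 2 / 2) ∂FX) atTop
      (𝓝 (∫⁻ x, ENNReal.ofReal (x ^ 2 / 2) ∂FX)) := by
  refine lintegral_tendsto_of_tendsto_of_monotone (fun c => by fun_prop) ?_ ?_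
  · filter_upwards [hX] with x hx a b hab
    dsimp only
    gcongr
  · refine ae_of_all _ fun x => tendsto_const_nhds.congr' ?_
    filter_upwards [eventually_ge_atTop ⌈x⌉₊] with c hc
    rw [min_eq_left ((Nat.le_ceil x).trans (by exact_mod_cast hc))]

lemma minAge_eq : minAge FX =
    (∫⁻ x, ENNReal.ofReal x ∂FX)⁻¹ * ∫⁻ x, ENNReal.ofReal (x ^ 2 / 2) ∂FX := by
  have h : ∫⁻ x, ENNReal.ofReal (x ^ 2 / 2) ∂FX = 2⁻¹ * ∫⁻ x, ENNReal.ofReal (x ^ 2) ∂FX := by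
    rw [← lintegral_const_mul _ (by fun_prop)]
    congr 1 with x
    rw [ENNReal.ofReal_div_of_pos two_pos, div_eq_mul_inv, mul_comm]
    simp
  rw [minAge, h, div_eq_mul_inv, ENNReal.mul_inv (by simp) (by simp)]
  ring

lemma tendsto_inv_mul_ofReal_add (c : ℝ) :
    Tendsto (fun T : ℝ => (ENNReal.ofReal T)⁻¹ * ENNReal.ofReal (T + c)) atTop (𝓝 1) := by
  have h : Tendsto (fun T : ℝ => ENNReal.ofReal (1 + c * T⁻¹)) atTop (𝓝 1) := by
    rw [← ENNReal.ofReal_one]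
    refine ENNReal.tendsto_ofReal ?_
    simpa using (tendsto_inv_atTop_zero.const_mul c).const_add 1
  refine h.congr' ?_
  filter_upwards [eventually_gt_atTop 0] with T hT
  rw [← ENNReal.ofReal_inv_of_pos hT, ← ENNReal.ofReal_mul (by positivity)]
  congr 1
  field_simp

/-! ### The lower bound -/

variable (FS : Measure ℝ) [IsProbabilityMeasure FX] [IsProbabilityMeasure FS] {a₀ : ℝ}

/-- The pathwise lower bound together with Wald's identity. -/
lemma renewal_mul_le_lintegral_age (ha₀ : 0 ≤ a₀) (hX : ∀ᵐ x ∂FX, 0 ≤ x) {c : ℝ} (hc : 0 ≤ c)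
    (T : ℝ) :
    renewal FX FS (T - c) * ∫⁻ x, ENNReal.ofReal (min x c ^ 2 / 2) ∂FX ≤
      ∫⁻ w, (∫⁻ t in Set.Ioc 0 T, age a₀ (fun n => (w n).1) (fun n => (w n).2) t)
        ∂(inputLaw FX FS) := by
  rw [← lintegral_prod_fst FX FS (by fun_prop),
    ← lintegral_tsum_arrived_mul FX FS _ (by fun_prop)]
  refine lintegral_mono_ae ?_
  filter_upwards [ae_forall_nonneg FS hX] with w hw
  exact tsum_le_lintegral_age ha₀ (fun n => (w n).2) hw hc

theorem minAge_le_averageAge (ha₀ : 0 ≤ a₀) (hX : ∀ᵐ x ∂FX, 0 ≤ x)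
    (hm : ∫⁻ x, ENNReal.ofReal x ∂FX ≠ 0) :
    minAge FX ≤ averageAge a₀ FX FS := by
  rw [minAge_eq]
  refine le_of_tendsto' (ENNReal.Tendsto.const_mul (tendsto_lintegral_min_sq hX)
    (Or.inr (ENNReal.inv_ne_top.2 hm))) fun c => ?_
  set m := ∫⁻ x, ENNReal.ofReal x ∂FX
  set E := ∫⁻ x, ENNReal.ofReal (min x (c : ℝ) ^ 2 / 2) ∂FX
  have hlim : Tendsto (fun T : ℝ => (ENNReal.ofReal T)⁻¹ * ENNReal.ofReal (T + -c) * (m⁻¹ * E))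
      atTop (𝓝 (m⁻¹ * E)) := by
    simpa using ENNReal.Tendsto.mul_const (b := m⁻¹ * E) (tendsto_inv_mul_ofReal_add (-c))
      (Or.inl one_ne_zero)
  rw [← hlim.limsup_eq]
  refine limsup_le_limsup ?_
  filter_upwards [eventually_gt_atTop 0] with T hT
  rw [lintegral_const_mul' _ _ (by simpa using hT), mul_assoc]
  gcongr
  refine le_trans ?_ (renewal_mul_le_lintegral_age FS ha₀ hX (Nat.cast_nonneg c) T)
  rw [← mul_assoc]
  refine mul_le_mul_left ?_ _
  rw [← div_eq_mul_inv]
  refine ENNReal.div_le_of_le_mul ?_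
  exact ofReal_le_renewal_mul FS hX one_pos.le (lintegral_min_ne_zero hm one_pos) (T - c)

/-! ### The upper bound -/

/-- The probability that a packet is served before its successor is generated. -/
noncomputable def servedProb (FX FS : Measure ℝ) : ℝ≥0∞ := (FX.prod FS) {z | z.2 ≤ z.1}

lemma lintegral_ite_add_servedProb (FX FS : Measure ℝ) [IsProbabilityMeasure FX]
    [IsProbabilityMeasure FS] :
    ∫⁻ z : ℝ × ℝ, (if z.2 ≤ z.1 then 0 else 1) ∂(FX.prod FS) + servedProb FX FS = 1 := by
  have hms : MeasurableSet {z : ℝ × ℝ | z.2 ≤ z.1} :=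
    measurableSet_le measurable_snd measurable_fst
  have h : (fun z : ℝ × ℝ => if z.2 ≤ z.1 then (0 : ℝ≥0∞) else 1) =
      {z : ℝ × ℝ | z.2 ≤ z.1}ᶜ.indicator 1 := by
    ext z
    by_cases h : z.2 ≤ z.1 <;> simp [h]
  rw [h, lintegral_indicator_one hms.compl, servedProb, add_comm, measure_add_measure_compl hms,
    measure_univ]

/-- The mean of `ageBound` over the packets generated up to time `T`, summed: the contribution of
each packet is passed on to its successor with probability `1 - servedProb`. -/
lemma servedProb_mul_tsum_le (hm' : ∫⁻ x, ENNReal.ofReal x ∂FX ≠ ∞) (hX : ∀ᵐ x ∂FX, 0 ≤ x)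
    (T : ℝ) :
    servedProb FX FS * ∑' n, ∫⁻ w, arrived T (fun k => (w k).1) n *
        ageBound a₀ (fun k => (w k).1) (fun k => (w k).2) n ∂(inputLaw FX FS) ≤
      ENNReal.ofReal a₀ + renewal FX FS T * ∫⁻ x, ENNReal.ofReal x ∂FX := by
  set m := ∫⁻ x, ENNReal.ofReal x ∂FX with hmdef
  set r : ℕ → ℝ≥0∞ := fun n => ∫⁻ w, arrived T (fun k => (w k).1) n ∂(inputLaw FX FS) with hr
  set b : ℕ → ℝ≥0∞ := fun n => ∫⁻ w, arrived T (fun k => (w k).1) n *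
        ageBound a₀ (fun k => (w k).1) (fun k => (w k).2) n ∂(inputLaw FX FS) with hb
  set q := ∫⁻ z : ℝ × ℝ, (if z.2 ≤ z.1 then 0 else 1) ∂(FX.prod FS) with hq
  have hqp : q + servedProb FX FS = 1 := lintegral_ite_add_servedProb FX FS
  have hq_top : q ≠ ∞ := ne_top_of_le_ne_top ENNReal.one_ne_top (hqp ▸ le_self_add)
  have hprob : IsProbabilityMeasure (inputLaw FX FS) := by rw [inputLaw]; infer_instance
  have harr : ∀ n w, arrived T w n ≤ 1 := fun n w => by
    rw [arrived]; split_ifs <;> simp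
  have hr_top : ∀ n, r n ≠ ∞ := fun n => by
    refine ne_top_of_le_ne_top ENNReal.one_ne_top ((lintegral_mono fun w => harr n _).trans ?_)
    simp
  have hb0 : b 0 ≤ ENNReal.ofReal a₀ := by
    refine (lintegral_mono fun w => mul_le_mul_left (harr 0 _) _).trans ?_
    simp [ageBound]
  have hite : Measurable fun z : ℝ × ℝ => if z.2 ≤ z.1 then (0 : ℝ≥0∞) else 1 :=
    Measurable.ite (measurableSet_le measurable_snd measurable_fst) measurable_const
      measurable_const
  have hstep : ∀ n, b (n + 1) ≤ r n * m + b n * q := by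
    intro n
    have hA := measurable_past_arrived T n
    have hAB := hA.mul (measurable_past_ageBound a₀ n)
    have h1 := lintegral_past_mul FX FS hA
      (g := fun z => ENNReal.ofReal z.1) (by fun_prop)
    have h2 := lintegral_past_mul FX FS hAB hite
    rw [lintegral_prod_fst FX FS (g := fun x => ENNReal.ofReal x) (by fun_prop)] at h1
    rw [hr, hmdef, hb, hq]
    dsimp only
    simp only [Pi.mul_apply] at h2
    rw [← h1, ← h2, ← lintegral_add_left]
    · refine lintegral_mono_ae ?_
      filter_upwards [ae_forall_nonneg FS hX] with w hw
      have hle : arrived T (fun k => (w k).1) (n + 1) ≤ arrived T (fun k => (w k).1) n := by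
        simp only [arrived]
        have := genTime_mono hw n.le_succ
        split_ifs with h h' <;> simp
        exact absurd (this.trans h) h'
      refine (mul_le_mul_left hle _).trans_eq ?_
      simp only [ageBound]
      split_ifs <;> ring
    · exact (hA.mono (past_le n) le_rfl).mul
        ((ENNReal.measurable_ofReal.comp measurable_fst).comp (measurable_pi_apply n))
  have hb_top : ∀ n, b n ≠ ∞ := by
    intro n
    induction n with
    | zero => exact ne_top_of_le_ne_top ENNReal.ofReal_ne_top hb0
    | succ n ih =>
      refine ne_top_of_le_ne_top ?_ (hstep n)
      exact ENNReal.add_ne_top.2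
        ⟨ENNReal.mul_ne_top (hr_top n) hm', ENNReal.mul_ne_top ih hq_top⟩
  rw [← ENNReal.tsum_mul_left]
  refine ENNReal.tsum_le_of_sum_range_le fun N => ?_
  rw [← Finset.mul_sum]
  -- Partial sums are finite, so the term with the factor `q` can be cancelled below.
  set S := ∑ k ∈ Finset.range N, b k with hS
  have hS_top : S ≠ ∞ := ENNReal.sum_ne_top.2 fun k _ => hb_top k
  have hmain : S ≤ ENNReal.ofReal a₀ + renewal FX FS T * m + S * q := by
    calc S ≤ ∑ k ∈ Finset.range (N + 1), b k :=
          Finset.sum_le_sum_of_subset (Finset.range_mono N.le_succ)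
      _ = ∑ k ∈ Finset.range N, b (k + 1) + b 0 := Finset.sum_range_succ' _ _
      _ ≤ ∑ k ∈ Finset.range N, (r k * m + b k * q) + ENNReal.ofReal a₀ := by
          gcongr
          exact hstep _
      _ = (∑ k ∈ Finset.range N, r k) * m + S * q + ENNReal.ofReal a₀ := by
          rw [Finset.sum_add_distrib, ← Finset.sum_mul, ← Finset.sum_mul]
      _ ≤ renewal FX FS T * m + S * q + ENNReal.ofReal a₀ := by
          gcongr
          exact ENNReal.sum_le_tsum _
      _ = _ := by ring
  refine (ENNReal.add_le_add_iff_right (ENNReal.mul_ne_top hS_top hq_top)).1 ?_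
  refine le_trans (le_of_eq ?_) hmain
  rw [mul_comm _ S, ← mul_add, add_comm, hqp, mul_one]

lemma lintegral_age_le_renewal (hm : ∫⁻ x, ENNReal.ofReal x ∂FX ≠ 0)
    (hm' : ∫⁻ x, ENNReal.ofReal x ∂FX ≠ ∞) (hX : ∀ᵐ x ∂FX, 0 ≤ x) (hp : servedProb FX FS ≠ 0)
    (T : ℝ) :
    ∫⁻ w, (∫⁻ t in Set.Ioc 0 T, age a₀ (fun n => (w n).1) (fun n => (w n).2) t)
        ∂(inputLaw FX FS) ≤
      renewal FX FS T * ∫⁻ x, ENNReal.ofReal (x ^ 2 / 2) ∂FX +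
        (servedProb FX FS)⁻¹ *
          (ENNReal.ofReal a₀ + renewal FX FS T * ∫⁻ x, ENNReal.ofReal x ∂FX) *
          ∫⁻ z : ℝ × ℝ, ENNReal.ofReal (min z.1 z.2) ∂(FX.prod FS) := by
  have hpast : ∀ n, Measurable[past n] fun w : ℕ → ℝ × ℝ => arrived T (fun k => (w k).1) n *
      ageBound a₀ (fun k => (w k).1) (fun k => (w k).2) n := fun n =>
    (measurable_past_arrived T n).mul (measurable_past_ageBound a₀ n)
  have hmin : Measurable fun z : ℝ × ℝ => ENNReal.ofReal (min z.1 z.2) := by fun_prop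
  calc ∫⁻ w, (∫⁻ t in Set.Ioc 0 T, age a₀ (fun n => (w n).1) (fun n => (w n).2) t)
        ∂(inputLaw FX FS)
      ≤ ∫⁻ w, (∑' n, arrived T (fun k => (w k).1) n * ENNReal.ofReal ((w n).1 ^ 2 / 2) +
          ∑' n, arrived T (fun k => (w k).1) n *
            ageBound a₀ (fun k => (w k).1) (fun k => (w k).2) n *
              ENNReal.ofReal (min (w n).1 (w n).2)) ∂(inputLaw FX FS) := by
        refine lintegral_mono_ae ?_
        filter_upwards [ae_forall_nonneg FS hX, ae_tendsto_genTime FS hX one_pos.le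
          (lintegral_min_ne_zero hm one_pos)] with w hw htop
        refine (lintegral_age_le hw htop T).trans_eq ?_
        rw [← ENNReal.tsum_add]
        exact tsum_congr fun n => by ring
    _ = renewal FX FS T * ∫⁻ x, ENNReal.ofReal (x ^ 2 / 2) ∂FX +
        (∑' n, ∫⁻ w, arrived T (fun k => (w k).1) n *
          ageBound a₀ (fun k => (w k).1) (fun k => (w k).2) n ∂(inputLaw FX FS)) *
          ∫⁻ z : ℝ × ℝ, ENNReal.ofReal (min z.1 z.2) ∂(FX.prod FS) := by
        rw [lintegral_add_left, lintegral_tsum_arrived_mul FX FS T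
          (g := fun z => ENNReal.ofReal (z.1 ^ 2 / 2)) (by fun_prop),
          lintegral_prod_fst FX FS (g := fun x => ENNReal.ofReal (x ^ 2 / 2)) (by fun_prop),
          lintegral_tsum, ← ENNReal.tsum_mul_right]
        · congr 1
          exact tsum_congr fun n => lintegral_past_mul FX FS (hpast n) hmin
        · exact fun n => (((hpast n).mono (past_le n) le_rfl).mul
            (hmin.comp (measurable_pi_apply n))).aemeasurable
        · refine Measurable.tsum fun n => ?_
          exact ((measurable_past_arrived T n).mono (past_le n) le_rfl).mul (by fun_prop)
    _ ≤ _ := by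
        gcongr
        rw [← ENNReal.mul_le_iff_le_inv hp (measure_ne_top _ _)]
        exact servedProb_mul_tsum_le FS hm' hX T

/-- The average age exceeds the minimal one by at most `E[min(X, S)] / P(S ≤ X)`. -/
theorem averageAge_le (hm : ∫⁻ x, ENNReal.ofReal x ∂FX ≠ 0)
    (hm' : ∫⁻ x, ENNReal.ofReal x ∂FX ≠ ∞) (hX : ∀ᵐ x ∂FX, 0 ≤ x)
    (hX2 : ∫⁻ x, ENNReal.ofReal (x ^ 2 / 2) ∂FX ≠ ∞) (hp : servedProb FX FS ≠ 0) :
    averageAge a₀ FX FS ≤ (∫⁻ x, ENNReal.ofReal x ∂FX)⁻¹ *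
      (∫⁻ x, ENNReal.ofReal (x ^ 2 / 2) ∂FX + (∫⁻ x, ENNReal.ofReal x ∂FX) *
        (servedProb FX FS)⁻¹ * ∫⁻ z : ℝ × ℝ, ENNReal.ofReal (min z.1 z.2) ∂(FX.prod FS)) := by
  set m := ∫⁻ x, ENNReal.ofReal x ∂FX with hmdef
  set E₂ := ∫⁻ x, ENNReal.ofReal (x ^ 2 / 2) ∂FX
  set e := ∫⁻ z : ℝ × ℝ, ENNReal.ofReal (min z.1 z.2) ∂(FX.prod FS) with he
  set p := servedProb FX FS
  have he_top : e ≠ ∞ := by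
    refine ne_top_of_le_ne_top hm' ?_
    rw [he, hmdef, ← lintegral_prod_fst FX FS (g := fun x => ENNReal.ofReal x) (by fun_prop)]
    exact lintegral_mono fun z => ENNReal.ofReal_le_ofReal (min_le_left _ _)
  have hp_top : p⁻¹ ≠ ∞ := ENNReal.inv_ne_top.2 hp
  set D := E₂ + m * p⁻¹ * e with hD
  have hD_top : D ≠ ∞ := ENNReal.add_ne_top.2
    ⟨hX2, ENNReal.mul_ne_top (ENNReal.mul_ne_top hm' hp_top) he_top⟩
  have hlim : Tendsto (fun c : ℕ => (∫⁻ x, ENNReal.ofReal (min x c) ∂FX)⁻¹ * D) atTop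
      (𝓝 (m⁻¹ * D)) :=
    ENNReal.Tendsto.mul_const (tendsto_inv_iff.2 tendsto_lintegral_min) (Or.inr hD_top)
  -- The renewal function is bounded through the inter-generation times truncated at `c`.
  refine ge_of_tendsto hlim ?_
  filter_upwards [eventually_ge_atTop 1] with c hc
  have hc0 : (0 : ℝ) < c := by exact_mod_cast hc
  have hmc0 := lintegral_min_ne_zero hm hc0
  set mc := ∫⁻ x, ENNReal.ofReal (min x (c : ℝ)) ∂FX with hmc
  have hmc_top : mc ≠ ∞ := by
    refine ne_top_of_le_ne_top hm' (lintegral_mono fun x => ?_)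
    exact ENNReal.ofReal_le_ofReal (min_le_left _ _)
  have hK : mc⁻¹ * D ≠ ∞ := ENNReal.mul_ne_top (ENNReal.inv_ne_top.2 hmc0) hD_top
  have hK' : ENNReal.ofReal a₀ * (p⁻¹ * e) ≠ ∞ :=
    ENNReal.mul_ne_top ENNReal.ofReal_ne_top (ENNReal.mul_ne_top hp_top he_top)
  have hT0 : Tendsto (fun T : ℝ => (ENNReal.ofReal T)⁻¹) atTop (𝓝 0) := by
    rw [← ENNReal.inv_top]
    exact tendsto_inv_iff.2 ENNReal.tendsto_ofReal_atTop
  have hlimT : Tendsto (fun T : ℝ => (ENNReal.ofReal T)⁻¹ * ENNReal.ofReal (T + c) * (mc⁻¹ * D) +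
      (ENNReal.ofReal T)⁻¹ * (ENNReal.ofReal a₀ * (p⁻¹ * e))) atTop (𝓝 (mc⁻¹ * D)) := by
    have h1 := ENNReal.Tendsto.mul_const (b := mc⁻¹ * D) (tendsto_inv_mul_ofReal_add c)
      (Or.inr hK)
    have h2 := ENNReal.Tendsto.mul_const (b := ENNReal.ofReal a₀ * (p⁻¹ * e)) hT0 (Or.inr hK')
    simpa using h1.add h2
  rw [← hlimT.limsup_eq]
  refine limsup_le_limsup ?_
  filter_upwards [eventually_gt_atTop 0] with T hT
  have hren : renewal FX FS T ≤ ENNReal.ofReal (T + c) * mc⁻¹ := by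
    rw [← div_eq_mul_inv, ENNReal.le_div_iff_mul_le (Or.inl hmc0) (Or.inl hmc_top)]
    exact renewal_mul_le FS hX hc0.le T
  rw [lintegral_const_mul' _ _ (by simpa using hT)]
  calc _ ≤ (ENNReal.ofReal T)⁻¹ * (ENNReal.ofReal (T + c) * mc⁻¹ * E₂ +
        p⁻¹ * (ENNReal.ofReal a₀ + ENNReal.ofReal (T + c) * mc⁻¹ * m) * e) := by
        gcongr
        refine (lintegral_age_le_renewal FS hm hm' hX hp T).trans ?_
        gcongr
    _ = _ := by rw [hD]; ring

/-! ### Service times that concentrate at zero -/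

/-- The bound is attained in the limit as soon as the service times tend to zero in probability. -/
theorem tendsto_averageAge (ha₀ : 0 ≤ a₀) (hX : ∀ᵐ x ∂FX, 0 ≤ x)
    (hm : ∫⁻ x, ENNReal.ofReal x ∂FX ≠ 0) (hm' : ∫⁻ x, ENNReal.ofReal x ∂FX ≠ ∞)
    {ι : Type*} {l : Filter ι} {F : ι → Measure ℝ} (hF : ∀ᶠ η in l, IsProbabilityMeasure (F η))
    (htail : ∀ x : ℝ, 0 < x → Tendsto (fun η => F η (Set.Ioi x)) l (𝓝 0)) :
    Tendsto (fun η => averageAge a₀ FX (F η)) l (𝓝 (minAge FX)) := by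
  by_cases hX2 : ∫⁻ x, ENNReal.ofReal (x ^ 2 / 2) ∂FX = ∞
  · have htop : minAge FX = ∞ := by
      rw [minAge_eq, hX2, ENNReal.mul_top (ENNReal.inv_ne_zero.2 hm')]
    rw [htop]
    refine tendsto_const_nhds.congr' ?_
    filter_upwards [hF] with η hη
    exact (top_le_iff.1 (htop ▸ minAge_le_averageAge (F η) ha₀ hX hm)).symm
  -- Inter-generation times are at least `δ` with positive probability.
  obtain ⟨δ, hδ, hδpos⟩ : ∃ δ : ℝ, 0 < δ ∧ FX (Set.Ioi δ) ≠ 0 := by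
    by_contra! h
    refine hm ((lintegral_eq_zero_iff (by fun_prop)).2 ?_)
    have h' : ∀ n : ℕ, ∀ᵐ x ∂FX, x ≤ 1 / ((n : ℝ) + 1) := fun n => by
      rw [ae_iff]
      simpa [Set.Ioi] using h (1 / ((n : ℝ) + 1)) Nat.one_div_pos_of_nat
    filter_upwards [ae_all_iff.2 h'] with x hx
    rw [Pi.zero_apply, ENNReal.ofReal_eq_zero]
    exact ge_of_tendsto' tendsto_one_div_add_atTop_nhds_zero_nat hx
  set m := ∫⁻ x, ENNReal.ofReal x ∂FX with hmdef
  set E₂ := ∫⁻ x, ENNReal.ofReal (x ^ 2 / 2) ∂FX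
  set κ := FX (Set.Ioi δ) * 2⁻¹ with hκ
  have hκ0 : κ ≠ 0 := mul_ne_zero hδpos (by simp)
  have hserved : ∀ᶠ η in l, κ ≤ servedProb FX (F η) := by
    filter_upwards [hF, (htail δ hδ).eventually_le_const (u := 2⁻¹) (by simp)] with η hη hle
    have hIic : (2⁻¹ : ℝ≥0∞) ≤ F η (Set.Iic δ) := by
      rw [← Set.compl_Ioi, prob_compl_eq_one_sub measurableSet_Ioi, ← ENNReal.one_sub_inv_two]
      exact tsub_le_tsub_left hle 1
    calc κ ≤ FX (Set.Ioi δ) * F η (Set.Iic δ) := by rw [hκ]; gcongr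
      _ = (FX.prod (F η)) (Set.Ioi δ ×ˢ Set.Iic δ) := (Measure.prod_prod _ _).symm
      _ ≤ _ := measure_mono fun z (hz : z ∈ Set.Ioi δ ×ˢ Set.Iic δ) =>
          le_trans (b := δ) hz.2 (le_of_lt hz.1)
  set e : ι → ℝ≥0∞ := fun η => ∫⁻ z : ℝ × ℝ, ENNReal.ofReal (min z.1 z.2) ∂(FX.prod (F η)) with he
  have he_le : ∀ ε : ℝ, ∀ᶠ η in l, e η ≤ ENNReal.ofReal ε + m * F η (Set.Ioi ε) := by
    intro ε
    filter_upwards [hF] with η hη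
    calc e η ≤ ∫⁻ z : ℝ × ℝ, (ENNReal.ofReal ε +
          ENNReal.ofReal z.1 * (Set.Ioi ε).indicator 1 z.2) ∂(FX.prod (F η)) := by
          refine lintegral_mono fun z => ?_
          by_cases hz : z.2 ∈ Set.Ioi ε
          · rw [Set.indicator_of_mem hz, Pi.one_apply, mul_one]
            exact (ENNReal.ofReal_le_ofReal (min_le_left _ _)).trans le_add_self
          · rw [Set.indicator_of_notMem hz, mul_zero, add_zero]
            exact ENNReal.ofReal_le_ofReal ((min_le_right _ _).trans (not_lt.1 hz))
      _ = _ := by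
          rw [lintegral_add_left measurable_const, lintegral_const, measure_univ, mul_one,
            lintegral_prod_mul (f := fun x => ENNReal.ofReal x) (by fun_prop)
              (measurable_one.indicator measurableSet_Ioi).aemeasurable,
            lintegral_indicator_one measurableSet_Ioi]
  have he0 : Tendsto e l (𝓝 0) := by
    refine ENNReal.tendsto_nhds_zero.2 fun ε hε => ?_
    obtain ⟨ε', hε', hlt⟩ := ENNReal.lt_iff_exists_real_btwn.1 hε |>.imp fun a h => h
    have hε'0 : 0 < ε' := ENNReal.ofReal_pos.1 hlt.1
    have hlim : Tendsto (fun η => ENNReal.ofReal ε' + m * F η (Set.Ioi ε')) l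
        (𝓝 (ENNReal.ofReal ε')) := by
      simpa using (ENNReal.Tendsto.const_mul (htail ε' hε'0) (Or.inr hm')).const_add
        (ENNReal.ofReal ε')
    filter_upwards [he_le ε', hlim.eventually_le_const hlt.2] with η h1 h2
    exact h1.trans h2
  have hupper : Tendsto (fun η => m⁻¹ * (E₂ + m * κ⁻¹ * e η)) l (𝓝 (minAge FX)) := by
    have h1 := ENNReal.Tendsto.const_mul (a := m * κ⁻¹) he0
      (Or.inr (ENNReal.mul_ne_top hm' (ENNReal.inv_ne_top.2 hκ0)))
    have h2 := ENNReal.Tendsto.const_mul (a := m⁻¹) (h1.const_add E₂)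
      (Or.inr (ENNReal.inv_ne_top.2 hm))
    rw [minAge_eq]
    simpa using h2
  refine tendsto_of_tendsto_of_tendsto_of_le_of_le' tendsto_const_nhds hupper ?_ ?_
  · filter_upwards [hF] with η hη
    exact minAge_le_averageAge (F η) ha₀ hX hm
  · filter_upwards [hF, hserved] with η hη hs
    have hp : servedProb FX (F η) ≠ 0 := fun h => hκ0 (le_zero_iff.1 (h ▸ hs))
    refine (averageAge_le (F η) hm hm' hX hX2 hp).trans ?_
    gcongr

end

/-! ### Pareto service -/

lemma integral_paretoMeasure {t r : ℝ} (ht : 0 < t) (hr : 1 < r) :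
    ∫ s, s ∂(paretoMeasure t r) = r * t / (r - 1) := by
  have hmeas : Measurable (paretoPDF t r) := (measurable_paretoPDFReal t r).ennreal_ofReal
  have hind : ∀ s : ℝ, (paretoPDF t r s).toReal • s =
      (Set.Ici t).indicator (fun s => r * t ^ r * s ^ (-r)) s := by
    intro s
    by_cases hs : t ≤ s
    · have hs0 : 0 < s := ht.trans_le hs
      rw [Set.indicator_of_mem (Set.mem_Ici.2 hs), paretoPDF_of_le hs,
        ENNReal.toReal_ofReal (by positivity), smul_eq_mul, mul_assoc]
      congr 1
      nth_rewrite 2 [← Real.rpow_one s]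
      rw [← Real.rpow_add hs0]
      congr 1
      ring
    · rw [Set.indicator_of_notMem (by simpa using hs), paretoPDF_of_lt (not_le.1 hs)]
      simp
  rw [paretoMeasure, integral_withDensity_eq_integral_toReal_smul hmeas
    (ae_of_all _ fun s => ENNReal.ofReal_lt_top)]
  simp_rw [hind]
  rw [integral_indicator measurableSet_Ici, integral_Ici_eq_integral_Ioi, integral_const_mul,
    integral_Ioi_rpow_of_lt (by linarith) ht, neg_div, ← div_neg,
    show -(-r + 1) = r - 1 by ring, mul_div_assoc', mul_assoc, ← Real.rpow_add ht]
  simp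

lemma paretoMeasure_Ioi {t r x : ℝ} (ht : 0 < t) (hr : 0 < r) (hx : t ≤ x) :
    paretoMeasure t r (Set.Ioi x) = ENNReal.ofReal ((t / x) ^ r) := by
  have hx0 : 0 < x := ht.trans_le hx
  rw [paretoMeasure, withDensity_apply _ measurableSet_Ioi,
    setLIntegral_congr_fun measurableSet_Ioi (g := fun s =>
      ENNReal.ofReal (r * t ^ r * s ^ (-(r + 1))))
      fun s (hs : x < s) => paretoPDF_of_le (hx.trans hs.le),
    ← ofReal_integral_eq_lintegral_ofReal]
  · rw [integral_const_mul, integral_Ioi_rpow_of_lt (by linarith) hx0, Real.div_rpow ht.le hx0.le,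
      show -(r + 1) + 1 = -r by ring, Real.rpow_neg hx0.le]
    congr 1
    field_simp
  · exact (integrableOn_Ioi_rpow_of_lt (by linarith) hx0).const_mul _
  · filter_upwards [ae_restrict_mem measurableSet_Ioi] with s hs
    have : 0 < s := hx0.trans hs
    simp only [Pi.zero_apply]
    positivity

lemma paretoScale_pos {mu α : ℝ} (hmu : 0 < mu) (hα : 1 < α) : 0 < 1 / mu * (1 - 1 / α) := by
  have : 1 / α < 1 := by rwa [div_lt_one (by linarith)]
  have : 0 < 1 - 1 / α := by linarith
  positivity

lemma integral_paretoService {mu α : ℝ} (hmu : 0 < mu) (hα : 1 < α) :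
    ∫ s, s ∂(paretoService mu α) = 1 / mu := by
  rw [paretoService, integral_paretoMeasure (paretoScale_pos hmu hα) hα]
  have : α - 1 ≠ 0 := by linarith
  field_simp

lemma tendsto_paretoService_Ioi {mu : ℝ} (hmu : 0 < mu) {x : ℝ} (hx : 0 < x) :
    Tendsto (fun α => paretoService mu α (Set.Ioi x)) (𝓝[>] 1) (𝓝 0) := by
  have hcont : ContinuousAt (fun α : ℝ => 1 / mu * (1 - 1 / α)) 1 := by
    fun_prop (disch := norm_num)
  have hscale : Tendsto (fun α : ℝ => 1 / mu * (1 - 1 / α)) (𝓝[>] 1) (𝓝 0) := by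
    simpa using hcont.tendsto.mono_left nhdsWithin_le_nhds
  have hlim : Tendsto (fun α : ℝ => ENNReal.ofReal (1 / mu * (1 - 1 / α) / x)) (𝓝[>] 1) (𝓝 0) := by
    simpa using ENNReal.tendsto_ofReal (hscale.div_const x)
  refine tendsto_of_tendsto_of_tendsto_of_le_of_le' tendsto_const_nhds hlim
    (Eventually.of_forall fun _ => zero_le) ?_
  filter_upwards [self_mem_nhdsWithin, hscale.eventually_le_const hx] with α hα hle
  have hpos := paretoScale_pos hmu hα
  rw [paretoService, paretoMeasure_Ioi hpos (by linarith [Set.mem_Ioi.1 hα]) hle]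
  refine ENNReal.ofReal_le_ofReal ?_
  nth_rewrite 2 [← Real.rpow_one (1 / mu * (1 - 1 / α) / x)]
  exact Real.rpow_le_rpow_of_exponent_ge (by positivity) ((div_le_one hx).2 hle) (le_of_lt hα)

/-! ### Log-normal service -/

lemma integral_logNormalService {mu : ℝ} (hmu : 0 < mu) (σ : ℝ) :
    ∫ s, s ∂(logNormalService mu σ) = 1 / mu := by
  have h := congrFun (mgf_fun_id_gaussianReal (μ := 0) (v := 1)) σ
  rw [mgf] at h
  rw [logNormalService, integral_map (by fun_prop) (by fun_prop)]
  simp_rw [Real.exp_add]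
  rw [integral_const_mul, h, ← Real.exp_add, one_div, ← Real.exp_log (inv_pos.2 hmu), Real.log_inv]
  congr 1
  simp

/-- The tail bound is Chernoff's inequality at `σ / 2`. -/
lemma tendsto_logNormalService_Ioi {mu : ℝ} (x : ℝ) (hx : 0 < x) :
    Tendsto (fun σ => logNormalService mu σ (Set.Ioi x)) atTop (𝓝 0) := by
  set K := (Real.log x + Real.log mu) / 2 with hK
  have hlim : Tendsto (fun σ : ℝ => ENNReal.ofReal (Real.exp (-K - σ ^ 2 / 8))) atTop (𝓝 0) := by
    rw [← ENNReal.ofReal_zero]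
    refine ENNReal.tendsto_ofReal (Real.tendsto_exp_atBot.comp ?_)
    refine tendsto_atBot_add_const_left _ _ (tendsto_neg_atTop_atBot.comp ?_)
    exact (tendsto_pow_atTop two_ne_zero).atTop_div_const (by norm_num)
  refine tendsto_of_tendsto_of_tendsto_of_le_of_le' tendsto_const_nhds hlim
    (Eventually.of_forall fun _ => zero_le) ?_
  filter_upwards [eventually_gt_atTop 0] with σ hσ
  rw [logNormalService, Measure.map_apply (by fun_prop) measurableSet_Ioi]
  set ε := (Real.log x + Real.log mu + σ ^ 2 / 2) / σ with hε
  have hsub : (fun z => Real.exp (-Real.log mu - σ ^ 2 / 2 + σ * z)) ⁻¹' Set.Ioi x ⊆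
      {z | ε ≤ z} := by
    intro z hz
    have hz' : Real.log x < -Real.log mu - σ ^ 2 / 2 + σ * z := (Real.log_lt_iff_lt_exp hx).2 hz
    rw [Set.mem_ofPred_eq, hε, div_le_iff₀ hσ]
    linarith
  refine (measure_mono hsub).trans ?_
  rw [← ofReal_measureReal]
  refine ENNReal.ofReal_le_ofReal ?_
  refine (measure_ge_le_exp_mul_mgf ε (t := σ / 2) (by positivity)
    (integrable_exp_mul_gaussianReal _)).trans_eq ?_
  rw [mgf_fun_id_gaussianReal, ← Real.exp_add, hε, hK]
  congr 1
  push_cast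
  field_simp
  ring

/-! ### Weibull service -/

lemma weibullScale_pos {mu κ : ℝ} (hmu : 0 < mu) (hκ : 0 < κ) : 0 < weibullScale mu κ := by
  have := Real.Gamma_pos_of_pos (s := 1 + 1 / κ) (by positivity)
  rw [weibullScale]
  positivity

/-- The moments of the Weibull law with shape `κ` and scale `β`. -/
lemma lintegral_weibull_rpow {β κ p : ℝ} (hβ : 0 < β) (hκ : 0 < κ) (hp : 0 ≤ p) :
    ∫⁻ s in Set.Ioi 0, ENNReal.ofReal (κ / β * (s / β) ^ (κ - 1) * Real.exp (-(s / β) ^ κ)) *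
      ENNReal.ofReal (s ^ p) = ENNReal.ofReal (β ^ p * Real.Gamma (1 + p / κ)) := by
  set b := β ^ (-κ) with hb
  have hb0 : 0 < b := by positivity
  have heq : ∀ s ∈ Set.Ioi (0 : ℝ),
      ENNReal.ofReal (κ / β * (s / β) ^ (κ - 1) * Real.exp (-(s / β) ^ κ)) *
        ENNReal.ofReal (s ^ p) =
      ENNReal.ofReal (κ * b * (s ^ (p + κ - 1) * Real.exp (-b * s ^ κ))) := by
    intro s (hs : 0 < s)
    rw [← ENNReal.ofReal_mul (by positivity)]
    congr 1
    have h1 : (s / β) ^ κ = b * s ^ κ := by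
      rw [Real.div_rpow hs.le hβ.le, hb, Real.rpow_neg hβ.le, div_eq_inv_mul]
    have h2 : κ / β * (s / β) ^ (κ - 1) = κ * b * s ^ (κ - 1) := by
      rw [Real.rpow_sub_one (by positivity), h1, Real.rpow_sub_one hs.ne']
      field_simp
    rw [h1, h2, show p + κ - 1 = (κ - 1) + p by ring, Real.rpow_add hs, neg_mul]
    ring
  rw [setLIntegral_congr_fun measurableSet_Ioi heq, ← ofReal_integral_eq_lintegral_ofReal]
  · rw [integral_const_mul, integral_rpow_mul_exp_neg_mul_rpow hκ (by linarith) hb0,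
      sub_add_cancel]
    congr 1
    have h1 : b * b ^ (-(p + κ) / κ) = β ^ p := by
      nth_rewrite 1 [← Real.rpow_one b]
      rw [← Real.rpow_add hb0, hb, ← Real.rpow_mul hβ.le]
      congr 1
      field_simp
      ring
    rw [show 1 + p / κ = (p + κ) / κ by field_simp; ring, ← h1]
    field_simp
  · exact (integrableOn_rpow_mul_exp_neg_mul_rpow (by linarith) hκ hb0).const_mul _
  · filter_upwards [ae_restrict_mem measurableSet_Ioi] with s hs
    have : 0 < s := hs
    simp only [Pi.zero_apply]
    positivity

lemma lintegral_weibullService_rpow {mu κ p : ℝ} (hmu : 0 < mu) (hκ : 0 < κ) (hp : 0 ≤ p) :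
    ∫⁻ s, ENNReal.ofReal (s ^ p) ∂(weibullService mu κ) =
      ENNReal.ofReal (weibullScale mu κ ^ p * Real.Gamma (1 + p / κ)) := by
  rw [weibullService, lintegral_withDensity_eq_lintegral_mul _ (by fun_prop) (by fun_prop)]
  exact lintegral_weibull_rpow (weibullScale_pos hmu hκ) hκ hp

lemma isProbabilityMeasure_weibullService {mu κ : ℝ} (hmu : 0 < mu) (hκ : 0 < κ) :
    IsProbabilityMeasure (weibullService mu κ) := by
  constructor
  simpa using lintegral_weibullService_rpow hmu hκ le_rfl

lemma integral_weibullService {mu κ : ℝ} (hmu : 0 < mu) (hκ : 0 < κ) :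
    ∫ s, s ∂(weibullService mu κ) = 1 / mu := by
  have hpos : ∀ᵐ s ∂(weibullService mu κ), 0 ≤ s := by
    refine (withDensity_absolutelyContinuous _ _).ae_le ?_
    filter_upwards [ae_restrict_mem measurableSet_Ioi] with s hs
    exact le_of_lt hs
  have h := lintegral_weibullService_rpow hmu hκ zero_le_one
  simp only [Real.rpow_one] at h
  have hG := Real.Gamma_pos_of_pos (s := 1 + 1 / κ) (by positivity)
  rw [integral_eq_lintegral_of_nonneg_ae hpos aestronglyMeasurable_id, h, weibullScale,
    ENNReal.toReal_ofReal (by positivity)]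
  field_simp

/-- A weak form of Stirling's lower bound. -/
lemma rpow_mul_exp_neg_le_Gamma {m : ℝ} (hm : 0 < m) :
    m ^ m * Real.exp (-m) ≤ Real.Gamma (1 + m) := by
  have hint := Real.GammaIntegral_convergent (s := 1 + m) (by positivity)
  rw [Real.Gamma_eq_integral (by positivity), ← integral_exp_neg_Ioi, ← integral_const_mul]
  refine le_trans ?_ (setIntegral_mono_set hint ?_ (Set.Ioi_subset_Ioi hm.le).eventuallyLE)
  · refine setIntegral_mono_on ?_ (hint.mono_set (Set.Ioi_subset_Ioi hm.le)) measurableSet_Ioi ?_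
    · exact (integrableOn_exp_neg_Ioi m).const_mul _
    · intro t (ht : m < t)
      rw [add_sub_cancel_left, mul_comm]
      gcongr
  · filter_upwards [ae_restrict_mem measurableSet_Ioi] with t ht
    have : 0 < t := ht
    simp only [Pi.zero_apply]
    positivity

/-- The tail bound is Markov's inequality for the moment of order `κ`. -/
lemma weibullService_Ioi_le {mu κ x : ℝ} (hmu : 0 < mu) (hκ : 0 < κ) (hx : 0 < x) :
    weibullService mu κ (Set.Ioi x) ≤ ENNReal.ofReal ((mu * x) ^ (-κ) * (κ * Real.exp 1)) := by
  have hβ := weibullScale_pos hmu hκ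
  have hG := Real.Gamma_pos_of_pos (s := 1 + 1 / κ) (by positivity)
  have hmoment : ∫⁻ s, ENNReal.ofReal (s ^ κ) ∂(weibullService mu κ) =
      ENNReal.ofReal (weibullScale mu κ ^ κ) := by
    rw [lintegral_weibullService_rpow hmu hκ hκ.le, div_self hκ.ne', one_add_one_eq_two,
      Real.Gamma_two, mul_one]
  have hsub : Set.Ioi x ⊆ {s | ENNReal.ofReal (x ^ κ) ≤ ENNReal.ofReal (s ^ κ)} :=
    fun s (hs : x < s) => ENNReal.ofReal_le_ofReal (by gcongr)
  have hxκ : 0 < x ^ κ := by positivity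
  refine (measure_mono hsub).trans ((meas_ge_le_lintegral_div (by fun_prop)
    (by simpa using hxκ) ENNReal.ofReal_ne_top).trans ?_)
  rw [hmoment, ← ENNReal.ofReal_div_of_pos hxκ]
  refine ENNReal.ofReal_le_ofReal ?_
  have hstirling : (κ * Real.exp 1)⁻¹ ≤ Real.Gamma (1 + 1 / κ) ^ κ := by
    have h := rpow_mul_exp_neg_le_Gamma (m := 1 / κ) (by positivity)
    refine le_trans (le_of_eq ?_) (Real.rpow_le_rpow (by positivity) h hκ.le)
    rw [Real.mul_rpow (by positivity) (by positivity), ← Real.rpow_mul (by positivity),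
      one_div_mul_cancel hκ.ne', Real.rpow_one, ← Real.exp_mul, neg_mul,
      one_div_mul_cancel hκ.ne', Real.exp_neg]
    field_simp
  rw [weibullScale, Real.inv_rpow (by positivity), Real.mul_rpow hmu.le hG.le,
    Real.rpow_neg (by positivity), Real.mul_rpow hmu.le hx.le, div_eq_mul_inv, mul_inv, mul_inv]
  have h2 := inv_anti₀ (by positivity) hstirling
  rw [inv_inv] at h2
  calc _ = (mu ^ κ)⁻¹ * (x ^ κ)⁻¹ * (Real.Gamma (1 + 1 / κ) ^ κ)⁻¹ := by ring
    _ ≤ _ := by gcongr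

lemma tendsto_weibullService_Ioi {mu : ℝ} (hmu : 0 < mu) {x : ℝ} (hx : 0 < x) :
    Tendsto (fun κ => weibullService mu κ (Set.Ioi x)) (𝓝[>] 0) (𝓝 0) := by
  have hcont : ContinuousAt (fun κ : ℝ => (mu * x) ^ (-κ) * (κ * Real.exp 1)) 0 := by
    have : mu * x ≠ 0 := by positivity
    exact ((Real.continuousAt_const_rpow this).comp continuousAt_neg).mul (by fun_prop)
  have hlim : Tendsto (fun κ : ℝ => ENNReal.ofReal ((mu * x) ^ (-κ) * (κ * Real.exp 1)))
      (𝓝[>] 0) (𝓝 0) := by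
    simpa using ENNReal.tendsto_ofReal (hcont.tendsto.mono_left nhdsWithin_le_nhds)
  refine tendsto_of_tendsto_of_tendsto_of_le_of_le' tendsto_const_nhds hlim
    (Eventually.of_forall fun _ => zero_le) ?_
  filter_upwards [self_mem_nhdsWithin] with κ hκ
  exact weibullService_Ioi_le hmu hκ hx

end LCFSp

theorem mainTheorem3
    (FX : Measure ℝ) [IsProbabilityMeasure FX] (lam mu a₀ : ℝ)
    (hlam : 0 < lam) (hmu : 0 < mu) (ha₀ : 0 ≤ a₀)
    (hX : ∀ᵐ x ∂FX, 0 ≤ x) (hXmean : ∫ x, x ∂FX = 1 / lam) :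
    -- the lower bound, for every service time distribution
    (∀ FS : Measure ℝ, IsProbabilityMeasure FS → (∀ᵐ s ∂FS, 0 ≤ s) →
      LCFSp.minAge FX ≤ LCFSp.averageAge a₀ FX FS) ∧
    -- a sufficient condition for attaining the bound in the limit
    (∀ (ι : Type) (l : Filter ι) (F : ι → Measure ℝ),
      (∀ η, IsProbabilityMeasure (F η)) → (∀ (η : ι) (s : ℝ), F η {s} = 0) →
      (∀ η, ∀ᵐ s ∂(F η), 0 ≤ s) → (∀ η, ∫ s, s ∂(F η) = 1 / mu) →
      (∀ x : ℝ, 0 < x → Tendsto (fun η => F η (Set.Ioi x)) l (𝓝 0)) →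
      (∀ x : ℝ, 0 < x → Tendsto (fun η => ∫ s in Set.Iic x, s ∂(F η)) l (𝓝 0)) →
      Tendsto (fun η => LCFSp.averageAge a₀ FX (F η)) l (𝓝 (LCFSp.minAge FX))) ∧
    -- Pareto service
    ((∀ α : ℝ, 1 < α → IsProbabilityMeasure (LCFSp.paretoService mu α) ∧
        ∫ s, s ∂(LCFSp.paretoService mu α) = 1 / mu) ∧
      Tendsto (fun α => LCFSp.averageAge a₀ FX (LCFSp.paretoService mu α)) (𝓝[>] 1)
        (𝓝 (LCFSp.minAge FX))) ∧
    -- log-normal service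
    ((∀ σ : ℝ, 0 < σ → IsProbabilityMeasure (LCFSp.logNormalService mu σ) ∧
        ∫ s, s ∂(LCFSp.logNormalService mu σ) = 1 / mu) ∧
      Tendsto (fun σ => LCFSp.averageAge a₀ FX (LCFSp.logNormalService mu σ)) atTop
        (𝓝 (LCFSp.minAge FX))) ∧
    -- Weibull service
    ((∀ κ : ℝ, 0 < κ → IsProbabilityMeasure (LCFSp.weibullService mu κ) ∧
        ∫ s, s ∂(LCFSp.weibullService mu κ) = 1 / mu) ∧
      Tendsto (fun κ => LCFSp.averageAge a₀ FX (LCFSp.weibullService mu κ)) (𝓝[>] 0)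
        (𝓝 (LCFSp.minAge FX))) := by
  -- The integral of a non-integrable function would be zero.
  have hint : Integrable (fun x => x) FX := by
    refine not_imp_comm.1 integral_undef ?_
    rw [hXmean]
    positivity
  have hmean : ∫⁻ x, ENNReal.ofReal x ∂FX = ENNReal.ofReal (1 / lam) := by
    rw [← hXmean, ofReal_integral_eq_lintegral_ofReal hint hX]
  have hm : ∫⁻ x, ENNReal.ofReal x ∂FX ≠ 0 := by
    rw [hmean, Ne, ENNReal.ofReal_eq_zero, not_le]
    positivity
  have hm' : ∫⁻ x, ENNReal.ofReal x ∂FX ≠ ∞ := by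
    rw [hmean]
    exact ENNReal.ofReal_ne_top
  have hpareto : ∀ α : ℝ, 1 < α → IsProbabilityMeasure (LCFSp.paretoService mu α) :=
    fun α hα => isProbabilityMeasure_paretoMeasure (LCFSp.paretoScale_pos hmu hα) (by linarith)
  have hlogNormal : ∀ σ : ℝ, IsProbabilityMeasure (LCFSp.logNormalService mu σ) :=
    fun σ => Measure.isProbabilityMeasure_map (by fun_prop)
  refine ⟨fun FS _ _ => LCFSp.minAge_le_averageAge FS ha₀ hX hm, ?_, ⟨?_, ?_⟩, ⟨?_, ?_⟩, ⟨?_, ?_⟩⟩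
  · intro ι l F hF _ _ _ htail _
    exact LCFSp.tendsto_averageAge ha₀ hX hm hm' (Eventually.of_forall hF) htail
  · exact fun α hα => ⟨hpareto α hα, LCFSp.integral_paretoService hmu hα⟩
  · refine LCFSp.tendsto_averageAge ha₀ hX hm hm' ?_
      fun x hx => LCFSp.tendsto_paretoService_Ioi hmu hx
    filter_upwards [self_mem_nhdsWithin] with α hα using hpareto α hα
  · exact fun σ _ => ⟨hlogNormal σ, LCFSp.integral_logNormalService hmu σ⟩
  · exact LCFSp.tendsto_averageAge ha₀ hX hm hm' (Eventually.of_forall hlogNormal)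
      LCFSp.tendsto_logNormalService_Ioi
  · exact fun κ hκ => ⟨LCFSp.isProbabilityMeasure_weibullService hmu hκ,
      LCFSp.integral_weibullService hmu hκ⟩
  · refine LCFSp.tendsto_averageAge ha₀ hX hm hm' ?_
      fun x hx => LCFSp.tendsto_weibullService_Ioi hmu hx
    filter_upwards [self_mem_nhdsWithin] with κ hκ
    exact LCFSp.isProbabilityMeasure_weibullService hmu hκ
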